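/- Let $M \subseteq \widetilde M$ be a unital inclusion of tracial von Neumann algebras: $\widetilde M$ carries a faithful normal tracial state $\tau$, $M$ carries its restriction, and $\|x\|_2 = \tau(x^*x)^{1/2}$. Let $(\alpha,\beta)$ be an s-malleable deformation of $M$ inside $\widetilde M$: $\alpha:\mathbb R\to\operatorname{Aut}(\widetilde M,\tau)$ is an action by trace-preserving $*$-automorphisms with $\|\alpha_t(x)-x\|_2\to 0$ as $t\to 0$ for every $x\in\widetilde M$, and $\beta\in\operatorname{Aut}(\widetilde M,\tau)$ satisfies $\beta|_M=\mathrm{id}$, $\beta^2=\mathrm{id}$ and $\beta\alpha_t=\alpha_{-t}\beta$ for all $t\in\mathbb R$. For a von Neumann subalgebra $N$ of $M$ (all subalgebras contain the unit of $\widetilde M$) put $$\epsilon_t(N)=\sup_{x\in N,\ \|x\|\le 1}\|\alpha_t(x)-x\|_2,$$ and let $\operatorname{Rig}(\alpha)$ be the set of von Neumann subalgebras $N\subseteq M$ with $\epsilon_t(N)\to 0$ as $t\to 0$. Then for every $Q\in\operatorname{Rig}(\alpha)$ with $Q'\cap\widetilde M\subseteq M$ and every $t\in\mathbb R$, $$\frac1{24}\sup_{\substack{N\supseteq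 Q\\ N\in\operatorname{Rig}(\alpha)}}\epsilon_{4t}(N)\ \le\ \epsilon_{2t}(Q)\ \le\ 24\inf_{\substack{N\subseteq Q\\ N'\cap\widetilde M\subseteq M}}\epsilon_t(N),$$ where in the infimum $N$ ranges over the von Neumann subalgebras of $Q$ with $N'\cap\widetilde M\subseteq M$. -/

import Mathlib

open Filter Topology
open scoped ComplexOrder ENNReal

/-- A faithful normal tracial state on a (concretely represented) von Neumann algebra `A`.
Together with `A`, this is a tracial von Neumann algebra. -/
structure FaithfulNormalTrace {H : Type*} [NormedAddCommGroup H] [InnerProductSpace ℂ H]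
    [CompleteSpace H] (A : VonNeumannAlgebra H) where
  /-- The underlying linear functional. -/
  toLinearMap : A.toStarSubalgebra →ₗ[ℂ] ℂ
  map_one : toLinearMap 1 = 1
  nonneg : ∀ x : A.toStarSubalgebra, 0 ≤ toLinearMap (star x * x)
  tracial : ∀ x y : A.toStarSubalgebra, toLinearMap (x * y) = toLinearMap (y * x)
  faithful : ∀ x : A.toStarSubalgebra, toLinearMap (star x * x) = 0 → x = 0
  /-- Normality, that is continuity in the ultraweak topology, whose continuous functionals are
  exactly the sums `∑ ⟪ξₙ, x ηₙ⟫` with `ξ` and `η` square-summable sequences of vectors. -/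
  normal : ∃ ξ η : ℕ → H, Summable (fun n => ‖ξ n‖ ^ 2) ∧ Summable (fun n => ‖η n‖ ^ 2) ∧
    ∀ x : A.toStarSubalgebra,
      HasSum (fun n => inner ℂ (ξ n) ((x : H →L[ℂ] H) (η n))) (toLinearMap x)

/-- The `2`-norm `‖x‖₂ = τ(x* x) ^ (1/2)`. -/
noncomputable def FaithfulNormalTrace.norm2 {H : Type*} [NormedAddCommGroup H]
    [InnerProductSpace ℂ H] [CompleteSpace H] {A : VonNeumannAlgebra H}
    (τ : FaithfulNormalTrace A) (x : A.toStarSubalgebra) : ℝ :=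
  √(τ.toLinearMap (star x * x)).re

/-- The relative commutant `N' ∩ A`, as a set of operators. -/
def relCommutant {H : Type*} [NormedAddCommGroup H] [InnerProductSpace ℂ H] [CompleteSpace H]
    (N A : VonNeumannAlgebra H) : Set (H →L[ℂ] H) :=
  (N.commutant : Set (H →L[ℂ] H)) ∩ (A : Set (H →L[ℂ] H))

/-- An s-malleable deformation `(α, β)` of `M` inside the tracial von Neumann algebra `(A, τ)`:
`α` is an action of `ℝ` on `A` by trace-preserving `*`-automorphisms which is pointwise
continuous in the `2`-norm, and `β` is a trace-preserving `*`-automorphism of `A` with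
`β² = id`, `β|_M = id`, `β α_t = α_{-t} β`. -/
structure SMalleableDeformation {H : Type*} [NormedAddCommGroup H] [InnerProductSpace ℂ H]
    [CompleteSpace H] (M A : VonNeumannAlgebra H) (τ : FaithfulNormalTrace A) where
  /-- The one-parameter group. -/
  α : ℝ → (A.toStarSubalgebra ≃⋆ₐ[ℂ] A.toStarSubalgebra)
  /-- The reversing involution. -/
  β : A.toStarSubalgebra ≃⋆ₐ[ℂ] A.toStarSubalgebra
  α_zero : ∀ x, α 0 x = x
  α_add : ∀ s t x, α (s + t) x = α s (α t x)
  α_trace : ∀ t x, τ.toLinearMap (α t x) = τ.toLinearMap x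
  α_tendsto : ∀ x, Tendsto (fun t => τ.norm2 (α t x - x)) (𝓝 0) (𝓝 0)
  β_trace : ∀ x, τ.toLinearMap (β x) = τ.toLinearMap x
  β_fix : ∀ x : A.toStarSubalgebra, (x : H →L[ℂ] H) ∈ M → β x = x
  β_β : ∀ x, β (β x) = x
  β_α : ∀ t x, β (α t x) = α (-t) (β x)

namespace SMalleableDeformation

/-- `ε_t(Q) = sup {‖α_t(x) - x‖₂ : x ∈ Q, ‖x‖ ≤ 1}`, as an extended nonnegative real. -/
noncomputable def eps {H : Type*} [NormedAddCommGroup H] [InnerProductSpace ℂ H]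
    [CompleteSpace H] {M A : VonNeumannAlgebra H} {τ : FaithfulNormalTrace A}
    (D : SMalleableDeformation M A τ) (t : ℝ) (Q : VonNeumannAlgebra H) : ℝ≥0∞ :=
  ⨆ (x : A.toStarSubalgebra) (_ : (x : H →L[ℂ] H) ∈ Q) (_ : ‖(x : H →L[ℂ] H)‖ ≤ 1),
    ENNReal.ofReal (τ.norm2 (D.α t x - x))

/-- `Rig(α)`: the von Neumann subalgebras `Q` of `M` with `ε_t(Q) → 0` as `t → 0`. -/
def Rig {H : Type*} [NormedAddCommGroup H] [InnerProductSpace ℂ H]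
    [CompleteSpace H] {M A : VonNeumannAlgebra H} {τ : FaithfulNormalTrace A}
    (D : SMalleableDeformation M A τ) : Set (VonNeumannAlgebra H) :=
  {Q | Q ≤ M ∧ Tendsto (fun t => D.eps t Q) (𝓝 0) (𝓝 0)}

end SMalleableDeformation

/-! Both inequalities are cases of one estimate: if `P ⊆ N`, `N` is rigid and `P' ∩ A ⊆ M`, then
`ε_{2t}(N) ≤ 4 ε_t(P)` (`eps_two_mul_le`).

Averaging `u α_t(u*)` over the unitaries of `P` gives a contraction `v` with `‖v - 1‖₂ ≤ ε_t(P)` and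
`y v = v α_t(y)` on `P` (`exists_intertwines`). Rigidity gives such intertwiners on `N` for small
times. If `z` intertwines at time `t`, then `α_t(β(z*) z)` does so at time `2t`. Since `z z*`
commutes with `N`, it lies in `M` and `β` fixes it, so doubling only raises `z* z` to higher powers
in the trace. A functional calculus correction of the initial intertwiner keeps all these powers
close to `1` in trace, so contractive, almost isometric intertwiners `z` on `N` exist at every time
(`exists_intertwines_almost_isometry`).

To compare the two, `v z*` commutes with `P`, so `β` fixes it. As `v` is near `1`, `β(z*)` is near
`z*`, and `β(z*) z` is near `z* z`, hence near `1`. It intertwines `α_t` and `α_{-t}` on `N`, which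
bounds `α_t(y) - α_{-t}(y)` uniformly (`traceNorm_deformation_le`). -/

/-! ### The 2-seminorm of a positive trace on a C⋆-algebra. -/

/-- A positive tracial functional on a unital C⋆-algebra. -/
structure IsPositiveTrace {B : Type*} [CStarAlgebra B] (φ : B →ₗ[ℂ] ℂ) : Prop where
  nonneg : ∀ x, 0 ≤ φ (star x * x)
  tracial : ∀ x y, φ (x * y) = φ (y * x)

/-- The seminorm `x ↦ φ(x* x) ^ (1/2)` attached to a functional. -/
noncomputable def traceNorm {B : Type*} [CStarAlgebra B] (φ : B →ₗ[ℂ] ℂ) (x : B) : ℝ :=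
  √(φ (star x * x)).re

namespace IsPositiveTrace

variable {B : Type*} [CStarAlgebra B] {φ : B →ₗ[ℂ] ℂ}

theorem map_nonneg [PartialOrder B] [StarOrderedRing B] (h : IsPositiveTrace φ) {x : B}
    (hx : 0 ≤ x) : 0 ≤ φ x := by
  obtain ⟨y, rfl⟩ := CStarAlgebra.nonneg_iff_eq_star_mul_self.mp hx
  exact h.nonneg y

/-- The positive linear map underlying a positive trace. -/
noncomputable def toPositiveLinearMap [PartialOrder B] [StarOrderedRing B]
    (h : IsPositiveTrace φ) : B →ₚ[ℂ] ℂ :=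
  PositiveLinearMap.mk₀ φ fun _ hx => h.map_nonneg hx

/-- The GNS seminorm supplies the triangle inequality, Cauchy–Schwarz and the bound for left
multiplication. -/
theorem traceNorm_eq_norm [PartialOrder B] [StarOrderedRing B] (h : IsPositiveTrace φ) (x : B) :
    traceNorm φ x = ‖h.toPositiveLinearMap.toPreGNS x‖ := rfl

theorem traceNorm_nonneg (x : B) : 0 ≤ traceNorm φ x := Real.sqrt_nonneg _

theorem sq_traceNorm (h : IsPositiveTrace φ) (x : B) :
    traceNorm φ x ^ 2 = (φ (star x * x)).re :=
  Real.sq_sqrt (Complex.nonneg_iff.mp (h.nonneg x)).1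

theorem traceNorm_add_le (h : IsPositiveTrace φ) (x y : B) :
    traceNorm φ (x + y) ≤ traceNorm φ x + traceNorm φ y := by
  let _ := CStarAlgebra.spectralOrder B
  have _ := CStarAlgebra.spectralOrderedRing B
  simp only [h.traceNorm_eq_norm, map_add]
  exact norm_add_le _ _

theorem traceNorm_neg (x : B) : traceNorm φ (-x) = traceNorm φ x := by
  simp [traceNorm]

theorem traceNorm_sub_rev (x y : B) : traceNorm φ (x - y) = traceNorm φ (y - x) := by
  rw [← traceNorm_neg, neg_sub]

theorem traceNorm_sub_le (h : IsPositiveTrace φ) (x y z : B) :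
    traceNorm φ (x - z) ≤ traceNorm φ (x - y) + traceNorm φ (y - z) := by
  simpa using h.traceNorm_add_le (x - y) (y - z)

theorem traceNorm_smul (h : IsPositiveTrace φ) {r : ℝ} (hr : 0 ≤ r) (x : B) :
    traceNorm φ (r • x) = r * traceNorm φ x := by
  rw [← sq_eq_sq₀ (traceNorm_nonneg _) (mul_nonneg hr (traceNorm_nonneg _)), mul_pow,
    h.sq_traceNorm, h.sq_traceNorm, star_smul, smul_mul_smul, star_trivial, ← Complex.coe_smul,
    map_smul, smul_eq_mul, Complex.re_ofReal_mul, sq]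

theorem convex_traceNorm_sub_le (h : IsPositiveTrace φ) (y : B) (e : ℝ) :
    Convex ℝ {x : B | traceNorm φ (x - y) ≤ e} := by
  intro x hx x' hx' a b ha hb hab
  change _ ≤ e at hx hx' ⊢
  have h1 : a • x + b • x' - y = a • (x - y) + b • (x' - y) := by
    rw [smul_sub, smul_sub, sub_add_sub_comm, ← add_smul, hab, one_smul]
  have h2 := h.traceNorm_add_le (a • (x - y)) (b • (x' - y))
  rw [h.traceNorm_smul ha, h.traceNorm_smul hb] at h2
  rw [h1]
  calc _ ≤ a * e + b * e := h2.trans (by gcongr)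
    _ = e := by rw [← add_mul, hab, one_mul]

theorem traceNorm_parallelogram (h : IsPositiveTrace φ) (x y : B) :
    traceNorm φ (x - y) ^ 2 =
      2 * traceNorm φ x ^ 2 + 2 * traceNorm φ y ^ 2 -
        4 * traceNorm φ ((2⁻¹ : ℝ) • x + (2⁻¹ : ℝ) • y) ^ 2 := by
  simp only [h.sq_traceNorm, ← smul_add, star_smul, smul_mul_smul, star_trivial]
  rw [← Complex.coe_smul, map_smul]
  simp only [star_add, star_sub, add_mul, sub_mul, mul_add, mul_sub, map_add, map_sub,
    smul_eq_mul, Complex.re_ofReal_mul, Complex.add_re, Complex.sub_re]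
  ring

theorem norm_apply_star_mul_le (h : IsPositiveTrace φ) (x y : B) :
    ‖φ (star x * y)‖ ≤ traceNorm φ x * traceNorm φ y := by
  let _ := CStarAlgebra.spectralOrder B
  have _ := CStarAlgebra.spectralOrderedRing B
  exact norm_inner_le_norm (𝕜 := ℂ) (h.toPositiveLinearMap.toPreGNS x)
    (h.toPositiveLinearMap.toPreGNS y)

theorem traceNorm_mul_le_left (h : IsPositiveTrace φ) {a : B} (ha : ‖a‖ ≤ 1) (x : B) :
    traceNorm φ (a * x) ≤ traceNorm φ x := by
  let _ := CStarAlgebra.spectralOrder B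
  have _ := CStarAlgebra.spectralOrderedRing B
  have h1 := (h.toPositiveLinearMap.leftMulMapPreGNS a).le_of_opNorm_le
    (c := 1) ((LinearMap.mkContinuous_norm_le _ (norm_nonneg a) _).trans ha)
    (h.toPositiveLinearMap.toPreGNS x)
  rw [one_mul] at h1
  exact h1

theorem traceNorm_star (h : IsPositiveTrace φ) (x : B) :
    traceNorm φ (star x) = traceNorm φ x := by
  simp only [traceNorm, star_star]
  rw [h.tracial]

theorem traceNorm_mul_le_right (h : IsPositiveTrace φ) {a : B} (ha : ‖a‖ ≤ 1) (x : B) :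
    traceNorm φ (x * a) ≤ traceNorm φ x := by
  rw [← h.traceNorm_star, star_mul, ← h.traceNorm_star x]
  exact h.traceNorm_mul_le_left (by rwa [norm_star]) _

theorem traceNorm_map {γ : B ≃⋆ₐ[ℂ] B} (hγ : ∀ x, φ (γ x) = φ x) (x : B) :
    traceNorm φ (γ x) = traceNorm φ x := by
  simp only [traceNorm, ← map_star, ← map_mul, hγ]

theorem traceNorm_one (hone : φ 1 = 1) : traceNorm φ 1 = 1 := by
  simp [traceNorm, hone]

end IsPositiveTrace

/-! ### Almost isometric contractions. -/

/-- A contraction `z` can be corrected on the right by a function of `z* z` so that all powers of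
`z* z` have trace close to `1`. -/
theorem IsPositiveTrace.exists_mul_almost_isometry {B : Type*} [CStarAlgebra B] {φ : B →ₗ[ℂ] ℂ}
    (h : IsPositiveTrace φ) {z : B} (hz : ‖z‖ ≤ 1) :
    ∃ g : B, (∀ y, Commute (star z * z) y → Commute g y) ∧ ‖z * g‖ ≤ 1 ∧
      ∀ m : ℕ, (φ (1 - (star (z * g) * (z * g)) ^ m)).re ≤ 2 * (φ (1 - star z * z)).re := by
  let _ := CStarAlgebra.spectralOrder B
  have _ := CStarAlgebra.spectralOrderedRing B
  set a := star z * z with ha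
  have hsa : IsSelfAdjoint a := IsSelfAdjoint.star_mul_self z
  have hspec : ∀ s ∈ spectrum ℝ a, 0 ≤ s ∧ s ≤ 1 := by
    intro s hs
    refine ⟨spectrum_nonneg_of_nonneg (star_mul_self_nonneg z) hs, ?_⟩
    have h1 : ‖a‖ ≤ 1 := by
      rw [ha, CStarRing.norm_star_mul_self]; nlinarith [norm_nonneg z]
    have h2 : a ≤ 1 := (CStarAlgebra.norm_le_one_iff_of_nonneg a (star_mul_self_nonneg z)).mp h1
    have h3 := (le_algebraMap_iff_spectrum_le (r := (1 : ℝ)) (a := a)).mp (by simpa using h2)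
    exact h3 s hs
  -- Right multiplication by `p(z* z)` replaces `z* z` by `q(z* z)`, and `q = 1` on `[1/2, 1]`; the
  -- cutoff at `1/2` keeps `p` continuous.
  let p : ℝ → ℝ := fun s => (√(max s (1 / 2)))⁻¹
  have hpos : ∀ s : ℝ, 0 < max s (1 / 2) := fun s => lt_max_of_lt_right (by norm_num)
  have hp : Continuous p := by
    refine Continuous.inv₀ (by fun_prop) fun s => ?_
    exact (Real.sqrt_pos.mpr (hpos s)).ne'
  let q : ℝ → ℝ := fun s => s / max s (1 / 2)
  have hq : Continuous q := Continuous.div (by fun_prop) (by fun_prop) fun s => (hpos s).ne'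
  have hpq : (fun s => p s * s * p s) = q := by
    funext s
    have : √(max s (1 / 2)) ^ 2 = max s (1 / 2) := Real.sq_sqrt (hpos s).le
    have h2 : p s * s * p s = s * ((√(max s (1 / 2))) ^ 2)⁻¹ := by simp only [p]; ring
    rw [h2, this, ← div_eq_mul_inv]
  have hkey : star (z * cfc p a) * (z * cfc p a) = cfc q a := by
    have h1 : star (cfc p a) = cfc p a := (cfc_predicate p a : IsSelfAdjoint _).star_eq
    rw [star_mul, h1, ← hpq, cfc_mul (fun s => p s * s) p a (by fun_prop) (by fun_prop),
      cfc_mul p (fun s => s) a (by fun_prop) (by fun_prop), cfc_id' ℝ a]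
    simp only [ha, mul_assoc]
  have hq01 : ∀ s ∈ spectrum ℝ a, 0 ≤ q s ∧ q s ≤ 1 := by
    intro s hs
    exact ⟨div_nonneg (hspec s hs).1 (hpos s).le, (div_le_one (hpos s)).mpr (le_max_left _ _)⟩
  refine ⟨cfc p a, fun y hy => ?_, ?_, fun m => ?_⟩
  · exact Commute.cfc_real hy p
  · have h1 : ‖cfc q a‖ ≤ 1 := norm_cfc_le zero_le_one fun s hs => by
      rw [Real.norm_eq_abs, abs_of_nonneg (hq01 s hs).1]
      exact (hq01 s hs).2
    rw [← hkey, CStarRing.norm_star_mul_self] at h1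
    nlinarith [norm_nonneg (z * cfc p a)]
  · have h1 : 1 - (cfc q a) ^ m = cfc (fun s => 1 - q s ^ m) a := by
      rw [cfc_sub (fun _ => (1 : ℝ)) (fun s => q s ^ m) a (by fun_prop) (by fun_prop),
        cfc_const_one ℝ a, cfc_pow q m a (by fun_prop)]
    have h2 : (2 : ℝ) • (1 - a) = cfc (fun s : ℝ => 2 * (1 - s)) a := by
      rw [cfc_const_mul 2 (fun s : ℝ => 1 - s) a (by fun_prop),
        cfc_sub (fun _ => (1 : ℝ)) (fun s => s) a (by fun_prop) (by fun_prop),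
        cfc_const_one ℝ a, cfc_id' ℝ a]
    have h3 : 1 - (cfc q a) ^ m ≤ (2 : ℝ) • (1 - a) := by
      rw [h1, h2]
      refine cfc_mono (fun s hs => ?_) (by fun_prop) (by fun_prop)
      -- Above `1/2` the left side vanishes; below it, `1 - q ^ m ≤ 1 ≤ 2 (1 - s)`. The bound is
      -- therefore uniform in `m`.
      rcases le_total (1 / 2) s with hs2 | hs2
      · have : q s = 1 := by
          simp only [q]; rw [max_eq_left hs2]; exact div_self (by linarith)
        simp [this, (hspec s hs).2]
      · have := pow_nonneg (hq01 s hs).1 m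
        linarith
    have h4 := h.map_nonneg (sub_nonneg.mpr h3)
    rw [map_sub, ← Complex.coe_smul, map_smul] at h4
    have h5 := (Complex.nonneg_iff.mp h4).1
    rw [hkey]
    simpa using h5

/-- With `1 - z* z = c* c`, the square of `1 - z* z` is `1 - z* z - z* z c* c`, and traciality makes
the trace of the last product that of a positive element. -/
theorem IsPositiveTrace.sq_traceNorm_one_sub_le {B : Type*} [CStarAlgebra B] {φ : B →ₗ[ℂ] ℂ}
    (h : IsPositiveTrace φ) {z : B} (hz : ‖z‖ ≤ 1) :
    traceNorm φ (1 - star z * z) ^ 2 ≤ (φ (1 - star z * z)).re := by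
  let _ := CStarAlgebra.spectralOrder B
  have _ := CStarAlgebra.spectralOrderedRing B
  rw [h.sq_traceNorm]
  have h1 : ‖star z * z‖ ≤ 1 := by
    rw [CStarRing.norm_star_mul_self]; nlinarith [norm_nonneg z]
  have h2 : 0 ≤ 1 - star z * z := sub_nonneg.mpr
    ((CStarAlgebra.norm_le_one_iff_of_nonneg _ (star_mul_self_nonneg z)).mp h1)
  obtain ⟨c, hc⟩ := CStarAlgebra.nonneg_iff_eq_star_mul_self.mp h2
  have h3 : star z * z = 1 - star c * c := by rw [← hc, sub_sub_cancel]
  have h4 : star (1 - star z * z) * (1 - star z * z) =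
      1 - star z * z - star z * z * star c * c := by
    rw [mul_assoc _ (star c), ← hc]
    simp only [star_sub, star_mul, star_star, star_one]
    noncomm_ring
  have h5 : φ (star z * z * star c * c) = φ (star (z * star c) * (z * star c)) := by
    rw [h.tracial, star_mul, star_star]
    simp only [mul_assoc]
  rw [h4, map_sub, Complex.sub_re, h5]
  linarith [(Complex.nonneg_iff.mp (h.nonneg (z * star c))).1]

/-! ### Algebra of intertwiners. -/

/-- The element `z` intertwines the identity and `γ` on the set `T`. -/
def Intertwines {B : Type*} [CStarAlgebra B] (T : Set B) (γ : B ≃⋆ₐ[ℂ] B) (z : B) : Prop :=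
  ∀ y ∈ T, y * z = z * γ y

namespace Intertwines

variable {B : Type*} [CStarAlgebra B] {T : Set B} {γ : B ≃⋆ₐ[ℂ] B} {z w : B}

theorem star_mul (hT : ∀ y ∈ T, star y ∈ T) (hz : Intertwines T γ z) {y : B} (hy : y ∈ T) :
    star z * y = γ y * star z := by
  have h1 := congrArg star (hz _ (hT y hy))
  rwa [map_star, StarMul.star_mul, StarMul.star_mul, star_star, star_star] at h1

/-- This produces the elements of the relative commutant, on which `β` is trivial. -/
theorem mul_star_comm (hT : ∀ y ∈ T, star y ∈ T) (hz : Intertwines T γ z)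
    (hw : Intertwines T γ w) {y : B} (hy : y ∈ T) : y * (w * star z) = w * star z * y := by
  rw [← mul_assoc, hw y hy, mul_assoc, mul_assoc, hz.star_mul hT hy]

/-- Together with `mul_right`, this lets an intertwiner be corrected by functions of `z* z`. -/
theorem star_mul_comm (hT : ∀ y ∈ T, star y ∈ T) (hz : Intertwines T γ z)
    {y : B} (hy : y ∈ T) : Commute (star z * z) (γ y) := by
  rw [Commute, SemiconjBy, mul_assoc, ← hz y hy, ← mul_assoc, hz.star_mul hT hy, mul_assoc]

theorem mul_right (hz : Intertwines T γ z) {g : B} (hg : ∀ y ∈ T, Commute g (γ y)) :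
    Intertwines T γ (z * g) := fun y hy => by
  rw [← mul_assoc, hz y hy, mul_assoc, mul_assoc, (hg y hy).eq]

end Intertwines

/-! ### Doubling intertwiners and the transversality estimate. -/

section Deformation

variable {B : Type*} [CStarAlgebra B] {φ : B →ₗ[ℂ] ℂ} {α : ℝ → (B ≃⋆ₐ[ℂ] B)} {β : B ≃⋆ₐ[ℂ] B}
  {S T : Set B}

/-- The reflected intertwiner `β(z*) z` intertwines `α_{-t}` and `α_t`. -/
theorem reflect_intertwines (hβα : ∀ t x, β (α t x) = α (-t) (β x))
    (hT : ∀ y ∈ T, star y ∈ T) (hβT : ∀ y ∈ T, β y = y) {t : ℝ} {z : B}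
    (hz : Intertwines T (α t) z) {y : B} (hy : y ∈ T) :
    β (star z) * z * α t y = α (-t) y * (β (star z) * z) := by
  have h1 := congrArg β (hz.star_mul hT hy)
  rw [map_mul, map_mul, hβα, hβT y hy] at h1
  rw [mul_assoc, ← hz y hy, ← mul_assoc, h1, mul_assoc]

/-- Doubling the time of an intertwiner. -/
theorem exists_intertwines_two_mul (hφ : ∀ t x, φ (α t x) = φ x)
    (hα0 : ∀ x, α 0 x = x) (hα : ∀ s t x, α (s + t) x = α s (α t x))
    (hβα : ∀ t x, β (α t x) = α (-t) (β x))
    (hT : ∀ y ∈ T, star y ∈ T) (hβT : ∀ y ∈ T, β y = y)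
    (hcomm : ∀ b, (∀ y ∈ T, y * b = b * y) → β b = b) {t : ℝ} {z : B} (hz1 : ‖z‖ ≤ 1)
    (hz : Intertwines T (α t) z) :
    ∃ w, ‖w‖ ≤ 1 ∧ Intertwines T (α (2 * t)) w ∧
      ∀ m : ℕ, φ ((star w * w) ^ m) = φ ((star z * z) ^ (2 * m)) := by
  refine ⟨α t (β (star z) * z), ?_, fun y hy => ?_, fun m => ?_⟩
  · rw [StarAlgEquiv.norm_map]
    refine (norm_mul_le _ _).trans ?_
    rw [StarAlgEquiv.norm_map, norm_star]
    nlinarith [norm_nonneg z]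
  · rw [two_mul, hα, ← map_mul, reflect_intertwines hβα hT hβT hz hy, map_mul _ (α (-t) y), ← hα,
      add_neg_cancel, hα0]
  · have h1 : β (z * star z) = z * star z :=
      hcomm _ fun y hy => hz.mul_star_comm hT hz hy
    have h2 : star (β (star z) * z) * (β (star z) * z) = (star z * z) ^ 2 := by
      rw [StarMul.star_mul, ← map_star, star_star, mul_assoc, ← mul_assoc (β z), ← map_mul, h1]
      simp only [sq, mul_assoc]
    rw [← map_star, ← map_mul, ← map_pow, hφ, h2, pow_mul]

/-- The moment identity is exact, so iteration loses nothing beyond the growth of the exponent. -/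
theorem exists_intertwines_pow_two_mul (hφ : ∀ t x, φ (α t x) = φ x)
    (hα0 : ∀ x, α 0 x = x) (hα : ∀ s t x, α (s + t) x = α s (α t x))
    (hβα : ∀ t x, β (α t x) = α (-t) (β x))
    (hT : ∀ y ∈ T, star y ∈ T) (hβT : ∀ y ∈ T, β y = y)
    (hcomm : ∀ b, (∀ y ∈ T, y * b = b * y) → β b = b) {t : ℝ} {z : B} (hz1 : ‖z‖ ≤ 1)
    (hz : Intertwines T (α t) z) (k : ℕ) :
    ∃ w, ‖w‖ ≤ 1 ∧ Intertwines T (α (2 ^ k * t)) w ∧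
      ∀ m : ℕ, φ ((star w * w) ^ m) = φ ((star z * z) ^ (2 ^ k * m)) := by
  induction k with
  | zero => exact ⟨z, hz1, by simpa using hz, by simp⟩
  | succ k ih =>
    obtain ⟨w, hw1, hw, hwφ⟩ := ih
    obtain ⟨v, hv1, hv, hvφ⟩ :=
      exists_intertwines_two_mul hφ hα0 hα hβα hT hβT hcomm hw1 hw
    refine ⟨v, hv1, ?_, fun m => ?_⟩
    · rwa [← mul_assoc, ← pow_succ'] at hv
    · rw [hvφ, hwφ, pow_succ, mul_assoc]

/-- If the deformation converges uniformly on the unit ball of `T`, then for each time there are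
contractive intertwiners which are almost isometric. -/
theorem exists_intertwines_almost_isometry (h : IsPositiveTrace φ) (hone : φ 1 = 1)
    (hφ : ∀ t x, φ (α t x) = φ x)
    (hα0 : ∀ x, α 0 x = x) (hα : ∀ s t x, α (s + t) x = α s (α t x))
    (hβα : ∀ t x, β (α t x) = α (-t) (β x))
    (hT : ∀ y ∈ T, star y ∈ T) (hβT : ∀ y ∈ T, β y = y)
    (hcomm : ∀ b, (∀ y ∈ T, y * b = b * y) → β b = b)
    (hrig : ∀ e > 0, ∀ᶠ s in 𝓝 (0 : ℝ), ∃ v, ‖v‖ ≤ 1 ∧ traceNorm φ (v - 1) ≤ e ∧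
      Intertwines T (α s) v) (t : ℝ) {e : ℝ} (he : 0 < e) :
    ∃ z, ‖z‖ ≤ 1 ∧ Intertwines T (α t) z ∧ traceNorm φ (1 - star z * z) ≤ e := by
  -- The tolerance `e ^ 2 / 4` gives trace defect at most `e ^ 2 / 2` for `v* v`; the correction by
  -- `g` doubles it to `e ^ 2`, the bound needed for the squared norm.
  obtain ⟨k, v, hv1, hve, hv⟩ : ∃ k : ℕ, ∃ v, ‖v‖ ≤ 1 ∧ traceNorm φ (v - 1) ≤ e ^ 2 / 4 ∧
      Intertwines T (α (t / 2 ^ k)) v := by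
    have h1 : Tendsto (fun k : ℕ => t / 2 ^ k) atTop (𝓝 0) := by
      simpa [div_eq_mul_inv] using
        (tendsto_pow_atTop_nhds_zero_of_lt_one (r := (2 : ℝ)⁻¹) (by norm_num)
          (by norm_num)).const_mul t
    exact (h1.eventually (hrig (e ^ 2 / 4) (by positivity))).exists
  have hφv : (φ (1 - star v * v)).re ≤ e ^ 2 / 2 := by
    have h1 : 1 - e ^ 2 / 4 ≤ traceNorm φ v := by
      have h2 := h.traceNorm_sub_le 1 v 0
      rw [sub_zero, sub_zero, IsPositiveTrace.traceNorm_one hone,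
        IsPositiveTrace.traceNorm_sub_rev] at h2
      linarith
    rw [map_sub, Complex.sub_re, hone, ← h.sq_traceNorm, Complex.one_re]
    nlinarith [sq_nonneg (traceNorm φ v - 1)]
  obtain ⟨g, hg, hg1, hgφ⟩ := h.exists_mul_almost_isometry hv1
  obtain ⟨z, hz1, hz, hzφ⟩ := exists_intertwines_pow_two_mul hφ hα0 hα hβα hT hβT hcomm hg1
    (hv.mul_right fun y hy => hg _ (hv.star_mul_comm hT hy)) k
  refine ⟨z, hz1, ?_, ?_⟩
  · rwa [mul_div_cancel₀ _ (by positivity)] at hz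
  · have h1 := h.sq_traceNorm_one_sub_le hz1
    have h2 := hzφ 1
    have h3 := hgφ (2 ^ k * 1)
    rw [pow_one] at h2
    rw [map_sub, h2, ← map_sub] at h1
    refine (sq_le_sq₀ (IsPositiveTrace.traceNorm_nonneg _) he.le).mp ?_
    linarith

/-- The transversality estimate. -/
theorem traceNorm_deformation_le (h : IsPositiveTrace φ) (hone : φ 1 = 1)
    (hφ : ∀ t x, φ (α t x) = φ x) (hφβ : ∀ x, φ (β x) = φ x)
    (hα0 : ∀ x, α 0 x = x) (hα : ∀ s t x, α (s + t) x = α s (α t x))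
    (hβα : ∀ t x, β (α t x) = α (-t) (β x))
    (hST : S ⊆ T) (hS : ∀ y ∈ S, star y ∈ S) (hT : ∀ y ∈ T, star y ∈ T) (hβT : ∀ y ∈ T, β y = y)
    (hcomm : ∀ b, (∀ y ∈ S, y * b = b * y) → β b = b)
    (hrig : ∀ e > 0, ∀ᶠ s in 𝓝 (0 : ℝ), ∃ v, ‖v‖ ≤ 1 ∧ traceNorm φ (v - 1) ≤ e ∧
      Intertwines T (α s) v) {t e : ℝ} {v : B} (hv1 : traceNorm φ (v - 1) ≤ e)
    (hv : Intertwines S (α t) v) {y : B} (hy : y ∈ T) (hy1 : ‖y‖ ≤ 1) :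
    traceNorm φ (α (2 * t) y - y) ≤ 4 * e := by
  refine le_of_forall_pos_le_add fun δ hδ => ?_
  obtain ⟨z, hz1, hz, hzδ⟩ := exists_intertwines_almost_isometry h hone hφ hα0 hα hβα hT hβT
    (fun b hb => hcomm b fun y hy => hb y (hST hy)) hrig t (half_pos hδ)
  have hzS : Intertwines S (α t) z := fun y hy => hz y (hST hy)
  have hzs1 : ‖star z‖ ≤ 1 := by rwa [norm_star]
  -- Only `v z*` is known to commute with `S`, and this is where the hypothesis on the relative
  -- commutant of the smaller set enters.
  have hm : β (v * star z) = v * star z := hcomm _ fun y hy => hzS.mul_star_comm hS hv hy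
  have h1 : traceNorm φ (v * star z - star z) ≤ e := by
    have := h.traceNorm_mul_le_right hzs1 (v - 1)
    rw [sub_mul, one_mul] at this
    exact this.trans hv1
  have h2 : traceNorm φ (β (star z) - star z) ≤ 2 * e := by
    have h3 : traceNorm φ (β (v * star z - star z)) ≤ e := by
      rwa [IsPositiveTrace.traceNorm_map hφβ]
    rw [map_sub, hm, IsPositiveTrace.traceNorm_sub_rev] at h3
    linarith [h.traceNorm_sub_le (β (star z)) (v * star z) (star z)]
  set w := β (star z) * z with hw
  have h4 : traceNorm φ (w - 1) ≤ 2 * e + δ / 2 := by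
    have h5 := h.traceNorm_mul_le_right hz1 (β (star z) - star z)
    rw [sub_mul] at h5
    have h6 := h.traceNorm_sub_le w (star z * z) 1
    rw [IsPositiveTrace.traceNorm_sub_rev (star z * z)] at h6
    linarith
  have h7 : w * α t y = α (-t) y * w := reflect_intertwines hβα hT hβT hz hy
  have h8 : traceNorm φ (α t y - w * α t y) ≤ 2 * e + δ / 2 := by
    have := h.traceNorm_mul_le_right (a := α t y) (by rwa [StarAlgEquiv.norm_map]) (w - 1)
    rw [sub_mul, one_mul, IsPositiveTrace.traceNorm_sub_rev] at this
    exact this.trans h4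
  have h9 : traceNorm φ (w * α t y - α (-t) y) ≤ 2 * e + δ / 2 := by
    have := h.traceNorm_mul_le_left (a := α (-t) y) (by rwa [StarAlgEquiv.norm_map]) (w - 1)
    rw [mul_sub, mul_one, ← h7] at this
    exact this.trans h4
  -- Applying `α_t` turns the symmetric difference into the displacement at time `2t`.
  have h10 : traceNorm φ (α (2 * t) y - y) = traceNorm φ (α t y - α (-t) y) := by
    rw [← IsPositiveTrace.traceNorm_map (hφ t) (α t y - α (-t) y), map_sub, ← hα, ← hα,
      add_neg_cancel, hα0, two_mul]
  rw [h10]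
  linarith [h.traceNorm_sub_le (α t y) (w * α t y) (α (-t) y)]

end Deformation

/-! ### Averaging over a group of unitaries. -/

theorem norm_le_one_of_mem_unitary {B : Type*} [CStarAlgebra B] {u : B} (hu : u ∈ unitary B) :
    ‖u‖ ≤ 1 := by
  cases subsingleton_or_nontrivial B
  · simp [Subsingleton.elim u 0]
  · exact (CStarRing.norm_of_mem_unitary hu).le

/-- A sequence of almost `2`-norm-minimal elements in the convex hull of the `u γ(u*)`. -/
theorem IsPositiveTrace.exists_seq_almost_intertwines {B : Type*} [CStarAlgebra B]
    {φ : B →ₗ[ℂ] ℂ} (h : IsPositiveTrace φ) (γ : B ≃⋆ₐ[ℂ] B) (G : Submonoid B)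
    (hG : ∀ u ∈ G, u ∈ unitary B) {e : ℝ} (he : ∀ u ∈ G, traceNorm φ (γ u - u) ≤ e) :
    ∃ v : ℕ → B, ∀ n, ‖v n‖ ≤ 1 ∧ traceNorm φ (v n - 1) ≤ e ∧
      ∀ u ∈ G, traceNorm φ (u * v n * γ (star u) - v n) ^ 2 ≤ 4 * (1 / (n + 1)) := by
  have norm_le_one : ∀ u ∈ G, ‖u‖ ≤ 1 := fun u hu =>
    norm_le_one_of_mem_unitary (hG u hu)
  set E : Set B := (fun u => u * γ (star u)) '' (G : Set B) with hE
  set C : Set B := convexHull ℝ E with hC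
  have hCc : Convex ℝ C := convex_convexHull ℝ E
  have hC1 : ∀ x ∈ C, ‖x‖ ≤ 1 := by
    have : C ⊆ Metric.closedBall 0 1 := by
      refine convexHull_min ?_ (convex_closedBall 0 1)
      rintro _ ⟨u, hu, rfl⟩
      rw [mem_closedBall_zero_iff]
      refine (norm_mul_le _ _).trans ?_
      rw [StarAlgEquiv.norm_map, norm_star]
      nlinarith [norm_nonneg u, norm_le_one u hu]
    intro x hx
    exact mem_closedBall_zero_iff.mp (this hx)
  have hCe : ∀ x ∈ C, traceNorm φ (x - 1) ≤ e := by
    have : C ⊆ {x | traceNorm φ (x - 1) ≤ e} := by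
      refine convexHull_min ?_ (h.convex_traceNorm_sub_le 1 e)
      rintro _ ⟨u, hu, rfl⟩
      change traceNorm φ (u * γ (star u) - 1) ≤ e
      have hu1 : γ u * γ (star u) = 1 := by
        rw [← map_mul, Unitary.mul_star_self_of_mem (hG u hu), map_one]
      rw [← hu1, ← sub_mul]
      refine (h.traceNorm_mul_le_right ?_ _).trans ?_
      · rw [StarAlgEquiv.norm_map, norm_star]
        exact norm_le_one u hu
      · rw [traceNorm_sub_rev]
        exact he u hu
    exact fun x hx => this hx
  have hCu : ∀ u ∈ G, ∀ x ∈ C, u * x * γ (star u) ∈ C := by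
    intro u hu x hx
    let L : B →ₗ[ℝ] B := (LinearMap.mulRight ℝ (γ (star u))).comp (LinearMap.mulLeft ℝ u)
    have h1 : C ⊆ L ⁻¹' C := by
      refine convexHull_min ?_ (hCc.linear_preimage L)
      rintro _ ⟨w, hw, rfl⟩
      refine subset_convexHull ℝ E ⟨u * w, G.mul_mem hu hw, ?_⟩
      simp [L, mul_assoc]
    exact h1 hx
  have h1C : (1 : B) ∈ C := subset_convexHull ℝ E ⟨1, G.one_mem, by simp⟩
  -- The infimum need not be attained in `C`, so near-minimizers are used. The midpoint of `v n` and
  -- `u * v n * γ (star u)` lies in `C`, and the parallelogram law bounds their squared distance by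
  -- `4 / (n + 1)`.
  set m : ℝ := sInf ((fun x => traceNorm φ x ^ 2) '' C) with hm
  have hbdd : BddBelow ((fun x => traceNorm φ x ^ 2) '' C) :=
    ⟨0, by rintro _ ⟨x, -, rfl⟩; positivity⟩
  have hmle : ∀ x ∈ C, m ≤ traceNorm φ x ^ 2 := fun x hx => csInf_le hbdd ⟨x, hx, rfl⟩
  have hex : ∀ n : ℕ, ∃ x ∈ C, traceNorm φ x ^ 2 < m + 1 / (n + 1) := by
    intro n
    obtain ⟨_, ⟨x, hx, rfl⟩, hlt⟩ := exists_lt_of_csInf_lt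
      (Set.Nonempty.image (fun x => traceNorm φ x ^ 2) ⟨1, h1C⟩) (lt_add_of_pos_right m (Nat.one_div_pos_of_nat (n := n)))
    exact ⟨x, hx, hlt⟩
  choose v hvC hv using hex
  refine ⟨v, fun n => ⟨hC1 _ (hvC n), hCe _ (hvC n), fun u hu => ?_⟩⟩
  have h1 := hCu u hu _ (hvC n)
  have h2 := hmle _ (hCc h1 (hvC n) (a := 2⁻¹) (b := 2⁻¹) (by norm_num) (by norm_num)
    (by norm_num))
  have h3 : traceNorm φ (u * v n * γ (star u)) ≤ traceNorm φ (v n) := by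
    refine (h.traceNorm_mul_le_right ?_ _).trans
      (h.traceNorm_mul_le_left (norm_le_one u hu) _)
    rw [StarAlgEquiv.norm_map, norm_star]
    exact norm_le_one u hu
  have h4 : traceNorm φ (u * v n * γ (star u)) ^ 2 ≤ traceNorm φ (v n) ^ 2 :=
    pow_le_pow_left₀ (traceNorm_nonneg _) h3 2
  rw [h.traceNorm_parallelogram]
  linarith [hv n]

/-! ### Weak operator limits. -/

section WeakLimit

variable {H : Type*} [NormedAddCommGroup H] [InnerProductSpace ℂ H]

/-- Convergence of a sequence of operators in the weak operator topology. -/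
def WeakTendsto (x : ℕ → H →L[ℂ] H) (U : Filter ℕ) (y : H →L[ℂ] H) : Prop :=
  ∀ ξ η : H, Tendsto (fun n => inner ℂ ξ (x n η)) U (𝓝 (inner ℂ ξ (y η)))

namespace WeakTendsto

variable {x x' : ℕ → H →L[ℂ] H} {U : Filter ℕ} {y y' : H →L[ℂ] H}

theorem sub (hx : WeakTendsto x U y) (hx' : WeakTendsto x' U y') :
    WeakTendsto (fun n => x n - x' n) U (y - y') := fun ξ η => by
  simpa [inner_sub_right] using (hx ξ η).sub (hx' ξ η)

theorem const (y : H →L[ℂ] H) : WeakTendsto (fun _ => y) U y := fun _ _ => tendsto_const_nhds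

theorem mul_left [CompleteSpace H] (hx : WeakTendsto x U y) (a : H →L[ℂ] H) :
    WeakTendsto (fun n => a * x n) U (a * y) := fun ξ η => by
  simpa [ContinuousLinearMap.adjoint_inner_left] using
    hx (ContinuousLinearMap.adjoint a ξ) η

theorem mul_right (hx : WeakTendsto x U y) (a : H →L[ℂ] H) :
    WeakTendsto (fun n => x n * a) U (y * a) := fun ξ η => by
  simpa using hx ξ (a η)

/-- By the bicommutant theorem it suffices that commutation with a fixed operator survives weak
limits. -/
theorem mem_vonNeumannAlgebra [CompleteSpace H] [U.NeBot] (hx : WeakTendsto x U y) {A : VonNeumannAlgebra H}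
    (hA : ∀ n, x n ∈ A) : y ∈ A := by
  rw [← A.commutant_commutant, VonNeumannAlgebra.mem_commutant_iff]
  intro g hg
  rw [VonNeumannAlgebra.mem_commutant_iff] at hg
  ext η
  refine ext_inner_left ℂ fun ξ => ?_
  refine tendsto_nhds_unique (hx.mul_left g ξ η) ?_
  have h1 := hx.mul_right g ξ η
  simpa only [hg _ (hA _)] using h1

end WeakTendsto

/-- The unit ball of the bounded operators is compact in the weak operator topology. -/
theorem exists_weakTendsto [CompleteSpace H] (U : Ultrafilter ℕ) {x : ℕ → H →L[ℂ] H} (hx : ∀ n, ‖x n‖ ≤ 1) :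
    ∃ y : H →L[ℂ] H, ‖y‖ ≤ 1 ∧ WeakTendsto x U y := by
  have hbd : ∀ n ξ η, ‖inner ℂ ξ (x n η)‖ ≤ 1 * ‖ξ‖ * ‖η‖ := fun n ξ η => by
    refine (norm_inner_le_norm _ _).trans ?_
    rw [one_mul]
    gcongr
    simpa using (x n).le_of_opNorm_le (hx n) η
  have hlim : ∀ ξ η : H, ∃ c : ℂ, ‖c‖ ≤ 1 * ‖ξ‖ * ‖η‖ ∧
      Tendsto (fun n => inner ℂ ξ (x n η)) U (𝓝 c) := by
    intro ξ η
    obtain ⟨c, hc, hle⟩ := (isCompact_closedBall (0 : ℂ) (1 * ‖ξ‖ * ‖η‖)).ultrafilter_le_nhds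
      (U.map fun n => inner ℂ ξ (x n η)) (by
        rw [le_principal_iff]
        exact Filter.mem_map.mpr (Filter.univ_mem' fun n => by simpa using hbd n ξ η))
    exact ⟨c, by simpa using hc, hle⟩
  choose l hl1 hl using hlim
  -- The limits of the matrix coefficients form a bounded sesquilinear form, which is represented by
  -- an operator.
  let b : H →L⋆[ℂ] H →L[ℂ] ℂ := LinearMap.mkContinuous₂
    (LinearMap.mk₂'ₛₗ (starRingEnd ℂ) (RingHom.id ℂ) l
      (fun ξ ξ' η => tendsto_nhds_unique (hl _ _)
        (by simpa [inner_add_left] using (hl ξ η).add (hl ξ' η)))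
      (fun c ξ η => tendsto_nhds_unique (hl _ _)
        (by simpa [inner_smul_left, mul_comm] using (hl ξ η).const_mul (starRingEnd ℂ c)))
      (fun ξ η η' => tendsto_nhds_unique (hl _ _)
        (by simpa [inner_add_right] using (hl ξ η).add (hl ξ η')))
      (fun c ξ η => tendsto_nhds_unique (hl _ _)
        (by simpa [inner_smul_right] using (hl ξ η).const_mul c)))
    1 hl1
  let y := ContinuousLinearMap.adjoint (InnerProductSpace.continuousLinearMapOfBilin b)
  have hy : ∀ ξ η, inner ℂ ξ (y η) = l ξ η := fun ξ η => by
    simp only [y, ContinuousLinearMap.adjoint_inner_right,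
      InnerProductSpace.continuousLinearMapOfBilin_apply]
    rfl
  refine ⟨y, ContinuousLinearMap.opNorm_le_bound _ zero_le_one fun η => ?_, fun ξ η => ?_⟩
  · have h1 := hl1 (y η) η
    rw [← hy, inner_self_eq_norm_sq_to_K] at h1
    simp only [Complex.coe_algebraMap, norm_pow, Complex.norm_real, norm_norm, one_mul] at h1
    rw [one_mul]
    by_contra! hlt
    nlinarith [norm_nonneg η]
  · rw [hy]
    exact hl ξ η

end WeakLimit

/-! ### Exact intertwiners in a tracial von Neumann algebra. -/

namespace FaithfulNormalTrace

variable {H : Type*} [NormedAddCommGroup H] [InnerProductSpace ℂ H] [CompleteSpace H]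
  {A : VonNeumannAlgebra H}

/-- A von Neumann algebra is a C⋆-algebra. -/
noncomputable instance cstarAlgebraVonNeumannAlgebra (A : VonNeumannAlgebra H) :
    CStarAlgebra A.toStarSubalgebra :=
  StarSubalgebra.cstarAlgebra A.toStarSubalgebra (h_closed := by
    rw [VonNeumannAlgebra.coe_toStarSubalgebra, ← A.centralizer_centralizer]
    exact Set.isClosed_centralizer _)

theorem isPositiveTrace (τ : FaithfulNormalTrace A) : IsPositiveTrace τ.toLinearMap :=
  ⟨τ.nonneg, τ.tracial⟩

theorem norm2_eq_traceNorm (τ : FaithfulNormalTrace A) (x : A.toStarSubalgebra) :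
    τ.norm2 x = traceNorm τ.toLinearMap x := rfl

/-- Normality writes the trace as a series of matrix coefficients, and the norm bound on `x n`
allows dominated convergence. -/
theorem tendsto_of_weakTendsto (τ : FaithfulNormalTrace A) {U : Filter ℕ}
    {x : ℕ → A.toStarSubalgebra} {y : A.toStarSubalgebra} {c : ℝ} (hx : ∀ n, ‖x n‖ ≤ c)
    (hxy : WeakTendsto (fun n => (x n : H →L[ℂ] H)) U y) :
    Tendsto (fun n => τ.toLinearMap (x n)) U (𝓝 (τ.toLinearMap y)) := by
  obtain ⟨ξ, η, hξ, hη, hs⟩ := τ.normal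
  simp only [← (hs _).tsum_eq]
  refine tendsto_tsum_of_dominated_convergence (bound := fun k => c * (‖ξ k‖ ^ 2 + ‖η k‖ ^ 2))
    ((hξ.add hη).mul_left c) (fun k => hxy _ _) (Eventually.of_forall fun n k => ?_)
  have hc : 0 ≤ c := (norm_nonneg _).trans (hx n)
  calc ‖inner ℂ (ξ k) ((x n : H →L[ℂ] H) (η k))‖
      ≤ ‖ξ k‖ * ‖(x n : H →L[ℂ] H) (η k)‖ := norm_inner_le_norm _ _
    _ ≤ ‖ξ k‖ * (c * ‖η k‖) := by
      gcongr
      exact (x n : H →L[ℂ] H).le_of_opNorm_le (hx n) _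
    _ = c * (‖ξ k‖ * ‖η k‖) := by ring
    _ ≤ c * (‖ξ k‖ ^ 2 + ‖η k‖ ^ 2) := by
      gcongr
      nlinarith [sq_nonneg (‖ξ k‖ - ‖η k‖), sq_nonneg (‖ξ k‖), sq_nonneg (‖η k‖)]

/-- The `2`-norm is lower semicontinuous for bounded weak convergence. -/
theorem norm2_le_of_weakTendsto (τ : FaithfulNormalTrace A) {U : Filter ℕ} [U.NeBot]
    {x : ℕ → A.toStarSubalgebra} {y : A.toStarSubalgebra} {c : ℝ} (hx : ∀ n, ‖x n‖ ≤ c)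
    (hxy : WeakTendsto (fun n => (x n : H →L[ℂ] H)) U y) {f : ℕ → ℝ} {e : ℝ}
    (hf : Tendsto f U (𝓝 e)) (hxf : ∀ n, τ.norm2 (x n) ≤ f n) : τ.norm2 y ≤ e := by
  have h1 : Tendsto (fun n => τ.toLinearMap (star y * x n)) U
      (𝓝 (τ.toLinearMap (star y * y))) :=
    τ.tendsto_of_weakTendsto (c := ‖star y‖ * c)
      (fun n => (norm_mul_le _ _).trans (by gcongr; exact hx n)) (hxy.mul_left (star y : _))
  have h2 : (τ.toLinearMap (star y * y)).re ≤ τ.norm2 y * e :=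
    le_of_tendsto_of_tendsto' ((Complex.continuous_re.tendsto _).comp h1)
      (hf.const_mul (τ.norm2 y)) fun n =>
        (Complex.re_le_norm _).trans <|
          (τ.isPositiveTrace.norm_apply_star_mul_le y (x n)).trans
            (mul_le_mul_of_nonneg_left (hxf n) (Real.sqrt_nonneg _))
  rw [← τ.isPositiveTrace.sq_traceNorm, ← norm2_eq_traceNorm] at h2
  have h3 : 0 ≤ e := ge_of_tendsto' hf fun n => (Real.sqrt_nonneg _).trans (hxf n)
  have h4 : 0 ≤ τ.norm2 y := Real.sqrt_nonneg _
  by_contra! hlt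
  nlinarith

theorem eq_zero_of_norm2_le_zero (τ : FaithfulNormalTrace A) {x : A.toStarSubalgebra}
    (hx : τ.norm2 x ≤ 0) : x = 0 := by
  refine τ.faithful x ?_
  have h1 := τ.isPositiveTrace.sq_traceNorm x
  rw [← norm2_eq_traceNorm, le_antisymm hx (Real.sqrt_nonneg _)] at h1
  have h2 := Complex.nonneg_iff.mp (τ.nonneg x)
  exact Complex.ext (by simpa using h1.symm) h2.2.symm

/-- Averaging: if an automorphism is uniformly close to the identity on the unit ball of a von
Neumann subalgebra, then an intertwiner close to `1` exists. -/
theorem exists_intertwines (τ : FaithfulNormalTrace A)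
    (γ : A.toStarSubalgebra ≃⋆ₐ[ℂ] A.toStarSubalgebra) {N : VonNeumannAlgebra H} (hN : N ≤ A)
    {e : ℝ} (he : ∀ x : A.toStarSubalgebra, (x : H →L[ℂ] H) ∈ N → ‖(x : H →L[ℂ] H)‖ ≤ 1 →
      τ.norm2 (γ x - x) ≤ e) :
    ∃ v, ‖v‖ ≤ 1 ∧ traceNorm τ.toLinearMap (v - 1) ≤ e ∧
      Intertwines {x : A.toStarSubalgebra | (x : H →L[ℂ] H) ∈ N} γ v := by
  let G : Submonoid A.toStarSubalgebra := unitary A.toStarSubalgebra ⊓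
    (N.toStarSubalgebra.toSubmonoid.comap A.toStarSubalgebra.subtype)
  have hG : ∀ u ∈ G, u ∈ unitary A.toStarSubalgebra := fun u hu => hu.1
  obtain ⟨v, hv⟩ := τ.isPositiveTrace.exists_seq_almost_intertwines γ G hG (e := e)
    fun u hu => he u hu.2 (show ‖u‖ ≤ 1 from norm_le_one_of_mem_unitary hu.1)
  -- An ultrafilter limit needs no metrizability of the unit ball, so `H` may be nonseparable.
  let U : Ultrafilter ℕ := hyperfilter ℕ
  obtain ⟨w, hw1, hw⟩ := exists_weakTendsto U (x := fun n => (v n : H →L[ℂ] H))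
    fun n => (hv n).1
  have hwA : w ∈ A := hw.mem_vonNeumannAlgebra fun n => (v n).2
  have hU : (U : Filter ℕ) ≤ atTop := Nat.hyperfilter_le_atTop
  let z : A.toStarSubalgebra := ⟨w, hwA⟩
  have hunit : ∀ u ∈ G, u * z * γ (star u) - z = 0 := by
    intro u hu
    have hu1 : ‖u‖ ≤ 1 := norm_le_one_of_mem_unitary hu.1
    refine τ.eq_zero_of_norm2_le_zero (τ.norm2_le_of_weakTendsto (U := U)
      (x := fun n => u * v n * γ (star u) - v n) (c := 2)
      (f := fun n : ℕ => √(4 * (1 / ((n : ℝ) + 1)))) (fun n => ?_) ?_ ?_ fun n => ?_)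
    · have h1 : ‖u * v n * γ (star u)‖ ≤ 1 * 1 * 1 := by
        refine (norm_mul_le _ _).trans (mul_le_mul ((norm_mul_le _ _).trans
          (mul_le_mul hu1 (hv n).1 (norm_nonneg _) zero_le_one)) ?_ (norm_nonneg _)
          (by norm_num))
        rwa [StarAlgEquiv.norm_map, norm_star]
      linarith [norm_sub_le (u * v n * γ (star u)) (v n), (hv n).1]
    · exact ((hw.mul_left (u : H →L[ℂ] H)).mul_right (γ (star u) : H →L[ℂ] H)).sub hw
    · have h1 : Tendsto (fun n : ℕ => √(4 * (1 / ((n : ℝ) + 1)))) atTop (𝓝 √(4 * 0)) :=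
        (tendsto_one_div_add_atTop_nhds_zero_nat.const_mul 4).sqrt
      rw [mul_zero, Real.sqrt_zero] at h1
      exact h1.mono_left hU
    · exact Real.le_sqrt_of_sq_le ((hv n).2.2 u hu)
  have hunit' : ∀ u ∈ G, u * z = z * γ u := by
    intro u hu
    have h1 : γ (star u) * γ u = 1 := by
      rw [← map_mul, Unitary.star_mul_self_of_mem hu.1, _root_.map_one]
    calc u * z = u * z * γ (star u) * γ u := by rw [mul_assoc _ (γ (star u)), h1, mul_one]
      _ = z * γ u := by rw [sub_eq_zero.mp (hunit u hu)]
  refine ⟨z, hw1, ?_, fun y hy => ?_⟩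
  · exact τ.norm2_le_of_weakTendsto (U := U) (x := fun n => v n - 1) (c := 2)
      (f := fun _ => e) (fun n => (norm_sub_le _ _).trans (by
        have : ‖(1 : A.toStarSubalgebra)‖ ≤ 1 :=
          norm_le_one_of_mem_unitary (one_mem (unitary _))
        linarith [(hv n).1]))
      (hw.sub (WeakTendsto.const 1)) tendsto_const_nhds fun n => (hv n).2.1
  -- The relation is linear in `y`, and the unitaries of `N` span `N`.
  · let ι : N.toStarSubalgebra →⋆ₐ[ℂ] A.toStarSubalgebra := StarSubalgebra.inclusion hN
    have key : ∀ x : N.toStarSubalgebra, ι x * z = z * γ (ι x) := by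
      intro x
      have hx : x ∈ Submodule.span ℂ (unitary N.toStarSubalgebra : Set N.toStarSubalgebra) := by
        rw [CStarAlgebra.span_unitary]
        trivial
      induction hx using Submodule.span_induction with
      | mem u hu => exact hunit' _ ⟨Unitary.map_mem ι hu, u.2⟩
      | zero => simp
      | add a b _ _ ha hb => rw [map_add, map_add, add_mul, mul_add, ha, hb]
      | smul c a _ ha => rw [map_smul, map_smul, smul_mul_assoc, mul_smul_comm, ha]
    exact key ⟨y, hy⟩

end FaithfulNormalTrace

/-! ### Transversality for rigid subalgebras. -/

namespace SMalleableDeformation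

variable {H : Type*} [NormedAddCommGroup H] [InnerProductSpace ℂ H] [CompleteSpace H]
  {M A : VonNeumannAlgebra H} {τ : FaithfulNormalTrace A}

theorem norm2_le_of_eps_le (D : SMalleableDeformation M A τ) {t e : ℝ} (he : 0 ≤ e)
    {N : VonNeumannAlgebra H} (hN : D.eps t N ≤ ENNReal.ofReal e) (x : A.toStarSubalgebra)
    (hx : (x : H →L[ℂ] H) ∈ N) (hx1 : ‖(x : H →L[ℂ] H)‖ ≤ 1) :
    τ.norm2 (D.α t x - x) ≤ e := by
  rw [← ENNReal.ofReal_le_ofReal_iff he]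
  refine le_trans ?_ hN
  exact le_iSup_of_le x (le_iSup_of_le hx (le_iSup_of_le hx1 le_rfl))

/-- The uniform transversality inequality between a rigid algebra `N` and a subalgebra `P` with
relative commutant inside `M`. -/
theorem eps_two_mul_le (D : SMalleableDeformation M A τ) (hMA : M ≤ A)
    {P N : VonNeumannAlgebra H} (hPN : P ≤ N) (hN : N ∈ D.Rig)
    (hP : relCommutant P A ⊆ (M : Set (H →L[ℂ] H))) (t : ℝ) :
    D.eps (2 * t) N ≤ 4 * D.eps t P := by
  -- The averaging lemma takes a real bound, so the value `⊤` is treated apart.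
  rcases eq_or_ne (D.eps t P) ⊤ with htop | htop
  · rw [htop, ENNReal.mul_top (by norm_num)]
    exact le_top
  have hNA : N ≤ A := hN.1.trans hMA
  obtain ⟨v, -, hv1, hv⟩ := τ.exists_intertwines (D.α t) (hPN.trans hNA)
    (D.norm2_le_of_eps_le ENNReal.toReal_nonneg (ENNReal.ofReal_toReal htop).ge)
  have hrig : ∀ e > 0, ∀ᶠ s in 𝓝 (0 : ℝ), ∃ v, ‖v‖ ≤ 1 ∧
      traceNorm τ.toLinearMap (v - 1) ≤ e ∧
      Intertwines {x : A.toStarSubalgebra | (x : H →L[ℂ] H) ∈ N} (D.α s) v := by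
    intro e he
    filter_upwards [hN.2.eventually (ge_mem_nhds (ENNReal.ofReal_pos.mpr he))] with s hs
    exact τ.exists_intertwines (D.α s) hNA (D.norm2_le_of_eps_le he.le hs)
  refine iSup_le fun x => iSup_le fun hx => iSup_le fun hx1 => ?_
  have hmain := traceNorm_deformation_le τ.isPositiveTrace τ.map_one D.α_trace D.β_trace D.α_zero
    D.α_add D.β_α (S := {x : A.toStarSubalgebra | (x : H →L[ℂ] H) ∈ P})
    (T := {x : A.toStarSubalgebra | (x : H →L[ℂ] H) ∈ N})
    (fun x hx => hPN hx) (fun x hx => star_mem (S := VonNeumannAlgebra H) hx)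
    (fun x hx => star_mem (S := VonNeumannAlgebra H) hx) (fun x hx => D.β_fix x (hN.1 hx))
    (fun b hb => D.β_fix b (hP ⟨VonNeumannAlgebra.mem_commutant_iff.mpr fun g hg =>
      congrArg Subtype.val (hb ⟨g, hNA (hPN hg)⟩ hg), b.2⟩)) hrig hv1 hv hx hx1
  refine (ENNReal.ofReal_le_ofReal hmain).trans ?_
  rw [ENNReal.ofReal_mul (by norm_num), ENNReal.ofReal_toReal htop]
  simp

end SMalleableDeformation

theorem corollary1p4 {H : Type*} [NormedAddCommGroup H] [InnerProductSpace ℂ H]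
    [CompleteSpace H] (M A : VonNeumannAlgebra H) (hMA : M ≤ A) (τ : FaithfulNormalTrace A)
    (D : SMalleableDeformation M A τ) (Q : VonNeumannAlgebra H) (hQ : Q ∈ D.Rig)
    (hQM : relCommutant Q A ⊆ (M : Set (H →L[ℂ] H))) (t : ℝ) :
    (1 / 24 : ℝ≥0∞) * (⨆ N ∈ {N : VonNeumannAlgebra H | Q ≤ N ∧ N ∈ D.Rig}, D.eps (4 * t) N)
        ≤ D.eps (2 * t) Q ∧
      D.eps (2 * t) Q ≤
        24 * ⨅ N ∈ {N : VonNeumannAlgebra H |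
          N ≤ Q ∧ relCommutant N A ⊆ (M : Set (H →L[ℂ] H))}, D.eps t N := by
  -- The argument yields the constant `4`, better than the `24` required.
  have h24 : ∀ x : ℝ≥0∞, 4 * x ≤ 24 * x := fun x => by gcongr; norm_num
  constructor
  · rw [one_div, mul_comm, ← div_eq_mul_inv]
    refine ENNReal.div_le_of_le_mul' (iSup₂_le fun N hN => ?_)
    -- Here `Q` is the smaller algebra, at time `2 * t`; in the second inequality `Q` is the larger,
    -- rigid one.
    rw [show 4 * t = 2 * (2 * t) by ring]
    exact (D.eps_two_mul_le hMA hN.1 hN.2 hQM (2 * t)).trans (h24 _)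
  · rw [ENNReal.mul_iInf_of_ne (by norm_num) (by norm_num)]
    refine le_iInf fun N => ?_
    rw [ENNReal.mul_iInf_of_ne (by norm_num) (by norm_num)]
    exact le_iInf fun hN => (D.eps_two_mul_le hMA hN.1 hQ hN.2 t).trans (h24 _)
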